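/- Let $d_1,\dots,d_n$ be integers, each larger than one, let $D=[d_1]\times\dots\times[d_n]$, and let $$I_D=\ker\Big(\mathbb{C}[x_i : i\in D]\to\mathbb{C}[\theta_{j,k} : j\in[n],\,k\in[d_j]],\qquad x_{i_1,\dots,i_n}\mapsto\prod_{j=1}^n\theta_{j,i_j}\Big)$$ be the toric ideal of the Segre variety of rank-one tensors. The algebraic matroid of $I_D$ is the matroid on $D$ in which $S\subseteq D$ is independent if and only if the residue classes of $x_i$, $i\in S$, in $\mathbb{C}[x_i : i\in D]/I_D$ are algebraically independent over $\mathbb{C}$; let $\mathrm{cl}:2^D\to 2^D$ be its closure function. For $E\subseteq D$ put $\mathbb{C}[E]=\mathbb{C}[x_e : e\in E]$ and let $V(I_D\cap\mathbb{C}[E])\subseteq\mathbb{C}^E$ be the complex zero set of the elimination ideal. For $E\subseteq E'\subseteq D$, the map $V(I_D\cap\mathbb{C}[E'])\to V(I_D\cap\mathbb{C}[E])$ induced by the coordinate projection $\mathbb{C}^{E'}\to\mathbb{C}^E$ is called generically finite-to-one if its fibers over all points of some dense Zariski open subset of $V(I_D\cap\mathbb{C}[E])$ are finite. Then for every $E\subseteq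 D$, the closure $\mathrm{cl}(E)$ is the largest set $E'$ with $E\subseteq E'\subseteq D$ such that the projection $\mathbb{C}^{E'}\to\mathbb{C}^E$ induces a generically finite-to-one map $V(I_D\cap\mathbb{C}[E'])\to V(I_D\cap\mathbb{C}[E])$. That is, $E'=\mathrm{cl}(E)$ has this property, and every set $E'$ that has it is contained in $\mathrm{cl}(E)$. -/

import Mathlib

open MvPolynomial

noncomputable section

namespace RankOneTensor

/-- The index set `D = [d₁] × ⋯ × [dₙ]` of the entries of a tensor. -/
abbrev Index {n : ℕ} (d : Fin n → ℕ) : Type := (j : Fin n) → Fin (d j)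

/-- The index set of the parameters `θ_{j,k}`, `j ∈ [n]`, `k ∈ [d_j]`. -/
abbrev Param {n : ℕ} (d : Fin n → ℕ) : Type := (j : Fin n) × Fin (d j)

/-- The `ℂ`-algebra homomorphism `x_{i₁,…,iₙ} ↦ ∏_j θ_{j,i_j}`. -/
def segreHom {n : ℕ} (d : Fin n → ℕ) :
    MvPolynomial (Index d) ℂ →ₐ[ℂ] MvPolynomial (Param d) ℂ :=
  aeval fun i : Index d => ∏ j : Fin n, X (⟨j, i j⟩ : Param d)

/-- The toric ideal `I_D` of the Segre variety, the kernel of `segreHom`. -/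
def toricIdeal {n : ℕ} (d : Fin n → ℕ) : Ideal (MvPolynomial (Index d) ℂ) :=
  RingHom.ker (segreHom d)

instance toricIdeal_isPrime {n : ℕ} (d : Fin n → ℕ) : (toricIdeal d).IsPrime :=
  RingHom.ker_isPrime (segreHom d)

instance quotient_faithfulSMul {σ : Type} (I : Ideal (MvPolynomial σ ℂ)) [I.IsPrime] :
    FaithfulSMul ℂ (MvPolynomial σ ℂ ⧸ I) :=
  (faithfulSMul_iff_algebraMap_injective ℂ (MvPolynomial σ ℂ ⧸ I)).mpr
    (algebraMap ℂ (MvPolynomial σ ℂ ⧸ I)).injective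

/-- The algebraic matroid on `σ` of a prime ideal `I ⊆ ℂ[x_i : i ∈ σ]`: a set `S ⊆ σ` is independent
if and only if the residue classes of the variables `x_i`, `i ∈ S`, in `ℂ[x_i : i ∈ σ] ⧸ I` are
algebraically independent over `ℂ` (see `algebraicMatroid_indep_iff`). -/
def algebraicMatroid {σ : Type} (I : Ideal (MvPolynomial σ ℂ)) [I.IsPrime] : Matroid σ :=
  (AlgebraicIndependent.matroid ℂ (MvPolynomial σ ℂ ⧸ I)).comap
    fun i => Ideal.Quotient.mk I (X i)

theorem algebraicMatroid_ground {σ : Type} (I : Ideal (MvPolynomial σ ℂ)) [I.IsPrime] :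
    (algebraicMatroid I).E = Set.univ := by
  simp [algebraicMatroid]

theorem algebraicMatroid_indep_iff {σ : Type} (I : Ideal (MvPolynomial σ ℂ)) [I.IsPrime]
    (S : Set σ) :
    (algebraicMatroid I).Indep S ↔
      AlgebraicIndependent ℂ fun i : S => Ideal.Quotient.mk I (X (i : σ)) := by
  rw [algebraicMatroid, Matroid.comap_indep_iff, AlgebraicIndependent.matroid_indep_iff]
  constructor
  · rintro ⟨h, hinj⟩
    exact h.comp (fun i : S => (⟨_, Set.mem_image_of_mem _ i.2⟩ : _ '' S))
      fun a b hab => Subtype.ext (hinj a.2 b.2 (congrArg Subtype.val hab))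
  · intro h
    refine ⟨?_, fun a ha b hb hab => congrArg Subtype.val
      (AlgebraicIndependent.injective h (a₁ := (⟨a, ha⟩ : S)) (a₂ := ⟨b, hb⟩) hab)⟩
    have hr := h.coe_range
    have he : Set.range (fun i : S => Ideal.Quotient.mk I (X (i : σ))) =
        (fun i => Ideal.Quotient.mk I (X i)) '' S := by
      ext y
      simp
    rwa [he] at hr

/-- The elimination ideal `I ∩ ℂ[E]` as an ideal of `ℂ[E] = ℂ[x_e : e ∈ E]`. -/
def eliminationIdeal {σ : Type} (I : Ideal (MvPolynomial σ ℂ)) (E : Set σ) :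
    Ideal (MvPolynomial E ℂ) :=
  I.comap (rename ((↑) : E → σ) : MvPolynomial E ℂ →ₐ[ℂ] MvPolynomial σ ℂ)

/-- The complex affine variety `V(I ∩ ℂ[E]) ⊆ ℂ^E`. -/
def eliminationVariety {σ : Type} (I : Ideal (MvPolynomial σ ℂ)) (E : Set σ) : Set (E → ℂ) :=
  zeroLocus ℂ (eliminationIdeal I E)

/-- The coordinate projection `ℂ^{E'} → ℂ^E` for `E ⊆ E'`. -/
def coordProj {σ : Type} {E E' : Set σ} (h : E ⊆ E') (x : E' → ℂ) : E → ℂ :=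
  fun e => x (Set.inclusion h e)

/-- `U` is a Zariski open subset of `Y`, where `Y ⊆ ℂ^τ` carries the subspace topology. -/
def IsZariskiOpenIn {τ : Type} (U Y : Set (τ → ℂ)) : Prop :=
  ∃ J : Ideal (MvPolynomial τ ℂ), U = Y \ zeroLocus ℂ J

/-- `U` is Zariski dense in `Y`: every polynomial that vanishes on `U` vanishes on `Y`. -/
def IsZariskiDenseIn {τ : Type} (U Y : Set (τ → ℂ)) : Prop :=
  U ⊆ Y ∧ Y ⊆ zeroLocus ℂ (vanishingIdeal ℂ U)

/-- `φ` induces a map `X → Y` that is generically finite-to-one: its fibers over the points of some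
Zariski dense, Zariski open subset of `Y` are finite. -/
def IsGenericallyFiniteToOne {σ τ : Type} (φ : (σ → ℂ) → (τ → ℂ))
    (X : Set (σ → ℂ)) (Y : Set (τ → ℂ)) : Prop :=
  Set.MapsTo φ X Y ∧
    ∃ U : Set (τ → ℂ), IsZariskiOpenIn U Y ∧ IsZariskiDenseIn U Y ∧
      ∀ y ∈ U, {x | x ∈ X ∧ φ x = y}.Finite

end RankOneTensor

end

open MvPolynomial

namespace RankOneTensor

/-! For any prime ideal, `e` lies in cl(E) exactly when `x_e` is a root of a polynomial over ℂ[E]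
with some coefficient outside `I ∩ ℂ[E]`. Choose one such coefficient for each element of cl(E):
where their product is nonzero, every coordinate of a fibre point is a root of a nonzero univariate
polynomial, so the fibre is finite. Maximality uses the torus action. If `e ∈ E'` is not in cl(E),
its exponent vector lies outside the rational span of those of `E`. A linear functional separating
them gives a one-parameter subgroup that fixes the coordinates in `E` and moves `x_e`. Its orbit
through a suitable point with nonzero parameters is infinite and lies in one fibre. -/

/-! ### Closure and finite fibres for a prime ideal -/

theorem coordProj_mapsTo {σ : Type} (I : Ideal (MvPolynomial σ ℂ)) {E E' : Set σ} (h : E ⊆ E') :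
    Set.MapsTo (coordProj h) (eliminationVariety I E') (eliminationVariety I E) := by
  intro x hx p hp
  have h1 : rename (Set.inclusion h) p ∈ eliminationIdeal I E' := by
    simpa [eliminationIdeal, Ideal.mem_comap, rename_rename, Function.comp_def] using hp
  have h2 := hx _ h1
  rwa [aeval_rename] at h2

instance eliminationIdeal_isPrime {σ : Type} (I : Ideal (MvPolynomial σ ℂ)) [I.IsPrime]
    (E : Set σ) : (eliminationIdeal I E).IsPrime := by
  unfold eliminationIdeal
  infer_instance

/-- The closure of `E` in the algebraic matroid of `I` consists of the `e` such that `x_e` satisfies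
a polynomial relation over `ℂ[E]` which is nontrivial modulo `I ∩ ℂ[E]`. -/
theorem mem_algebraicMatroid_closure_iff {σ : Type} (I : Ideal (MvPolynomial σ ℂ)) [I.IsPrime]
    (E : Set σ) (e : σ) :
    e ∈ (algebraicMatroid I).closure E ↔
      ∃ f : Polynomial (MvPolynomial E ℂ), (∃ k, f.coeff k ∉ eliminationIdeal I E) ∧
        f.eval₂ (rename ((↑) : E → σ) : MvPolynomial E ℂ →ₐ[ℂ] MvPolynomial σ ℂ).toRingHom
          (X e) ∈ I := by
  set q : MvPolynomial E ℂ →ₐ[ℂ] MvPolynomial σ ℂ ⧸ I :=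
    (Ideal.Quotient.mkₐ ℂ I).comp (rename ((↑) : E → σ)) with hq
  have hadj : Algebra.adjoin ℂ ((fun i => Ideal.Quotient.mk I (X i)) '' E) = q.range := by
    have : q = aeval (fun i : E => Ideal.Quotient.mk I (X (i : σ))) := by
      ext i; simp [hq]
    rw [this, ← Algebra.adjoin_range_eq_range_aeval]
    congr 1
    ext y; simp
  have hker (p : MvPolynomial E ℂ) : q p = 0 ↔ p ∈ eliminationIdeal I E := by
    simp [hq, eliminationIdeal, Ideal.mem_comap, Ideal.Quotient.eq_zero_iff_mem]
  have heval (f : Polynomial (MvPolynomial E ℂ)) :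
      Ideal.Quotient.mk I (f.eval₂ (rename ((↑) : E → σ) :
        MvPolynomial E ℂ →ₐ[ℂ] MvPolynomial σ ℂ).toRingHom (X e)) =
      f.eval₂ q.toRingHom (Ideal.Quotient.mk I (X e)) := by
    rw [Polynomial.hom_eval₂]
    rfl
  have hmem : e ∈ (algebraicMatroid I).closure E ↔
      IsAlgebraic q.range (Ideal.Quotient.mk I (X e)) := by
    rw [algebraicMatroid, Matroid.comap_closure_eq, AlgebraicIndependent.matroid_closure_eq,
      Set.mem_preimage, SetLike.mem_coe, Subalgebra.mem_algebraicClosure, hadj]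
  have haeval (f : Polynomial (MvPolynomial E ℂ)) :
      Polynomial.aeval (Ideal.Quotient.mk I (X e)) (f.map q.rangeRestrict.toRingHom) =
      f.eval₂ q.toRingHom (Ideal.Quotient.mk I (X e)) := by
    rw [Polynomial.aeval_def, Polynomial.eval₂_map]
    rfl
  rw [hmem]
  constructor
  · rintro ⟨p, hp0, hp⟩
    obtain ⟨f, rfl⟩ := Polynomial.map_surjective q.rangeRestrict.toRingHom
      q.rangeRestrict_surjective p
    refine ⟨f, ?_, ?_⟩
    · by_contra! hall
      refine hp0 (Polynomial.ext fun k => Subtype.ext ?_)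
      simpa using (hker _).2 (hall k)
    · rw [← Ideal.Quotient.eq_zero_iff_mem, heval, ← haeval, hp]
  · rintro ⟨f, ⟨k, hk⟩, hf⟩
    refine ⟨f.map q.rangeRestrict.toRingHom, fun h0 => hk ((hker _).1 ?_), ?_⟩
    · have := congrArg (fun p => (p.coeff k : MvPolynomial σ ℂ ⧸ I)) h0
      simpa using this
    · rw [haeval, ← heval, Ideal.Quotient.eq_zero_iff_mem.2 hf]

theorem vanishingIdeal_eliminationVariety {σ : Type} [Finite σ] (I : Ideal (MvPolynomial σ ℂ))
    [I.IsPrime] (E : Set σ) :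
    vanishingIdeal ℂ (eliminationVariety I E) = eliminationIdeal I E := by
  rw [eliminationVariety, vanishingIdeal_zeroLocus_eq_radical,
    (eliminationIdeal_isPrime I E).isRadical.radical]

/-- The complement of a hypersurface is dense in an irreducible variety it does not contain. -/
theorem isZariskiDenseIn_sdiff {σ : Type} [Finite σ] (I : Ideal (MvPolynomial σ ℂ))
    [I.IsPrime] (E : Set σ) {c : MvPolynomial E ℂ} (hc : c ∉ eliminationIdeal I E) :
    IsZariskiDenseIn (eliminationVariety I E \ zeroLocus ℂ (Ideal.span {c}))
      (eliminationVariety I E) := by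
  refine ⟨Set.sdiff_subset, fun y hy q hq => hy q ?_⟩
  -- `q` vanishes where `c` does not, so `q * c` vanishes on the whole variety; primality then
  -- cancels `c`.
  have h : q * c ∈ eliminationIdeal I E := by
    rw [← vanishingIdeal_eliminationVariety]
    intro x hx
    by_cases hcx : aeval x c = 0
    · rw [map_mul, hcx, mul_zero]
    · rw [map_mul, hq x ⟨hx, fun h => hcx (h c (Ideal.mem_span_singleton_self c))⟩, zero_mul]
  exact ((eliminationIdeal_isPrime I E).mem_or_mem h).resolve_right hc

theorem subset_algebraicMatroid_closure {σ : Type} (I : Ideal (MvPolynomial σ ℂ)) [I.IsPrime]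
    (E : Set σ) : E ⊆ (algebraicMatroid I).closure E :=
  Matroid.subset_closure _ _ (by rw [algebraicMatroid_ground]; exact Set.subset_univ _)

theorem isGenericallyFiniteToOne_closure {σ : Type} [Finite σ] (I : Ideal (MvPolynomial σ ℂ))
    [I.IsPrime] (E : Set σ) :
    IsGenericallyFiniteToOne (coordProj (subset_algebraicMatroid_closure I E))
      (eliminationVariety I ((algebraicMatroid I).closure E)) (eliminationVariety I E) := by
  classical
  refine ⟨coordProj_mapsTo I _, ?_⟩
  set E' := (algebraicMatroid I).closure E with hE'
  have := Fintype.ofFinite E'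
  choose f hf hfI using fun e : E' => (mem_algebraicMatroid_closure_iff I E e).1 e.2
  choose k hk using hf
  set c : MvPolynomial E ℂ := ∏ e : E', (f e).coeff (k e) with hc
  have hcP : c ∉ eliminationIdeal I E := by
    rw [hc, (eliminationIdeal_isPrime I E).prod_mem_iff]
    rintro ⟨e, -, he⟩
    exact hk e he
  refine ⟨_, ⟨Ideal.span {c}, rfl⟩, isZariskiDenseIn_sdiff I E hcP, fun y hy => ?_⟩
  have hcy : aeval y c ≠ 0 := fun h0 => hy.2 fun p hp => by
    obtain ⟨r, rfl⟩ := Ideal.mem_span_singleton'.1 hp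
    rw [map_mul, h0, mul_zero]
  have hne (e : E') : (f e).map (aeval y : MvPolynomial E ℂ →ₐ[ℂ] ℂ).toRingHom ≠ 0 := by
    intro h0
    rw [hc, map_prod, Finset.prod_ne_zero_iff] at hcy
    refine hcy e (Finset.mem_univ e) ?_
    simpa using congrArg (fun p => p.coeff (k e)) h0
  refine (Set.Finite.pi' fun e : E' => Polynomial.finite_setOfPred_isRoot (hne e)).subset ?_
  rintro x ⟨hx, rfl⟩ e
  -- The relation for `x_e` involves only variables in `E'`, so it holds at every point of the
  -- variety over `E'`.
  have hr : (f e).eval₂ (rename (Set.inclusion (subset_algebraicMatroid_closure I E)) :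
      MvPolynomial E ℂ →ₐ[ℂ] MvPolynomial E' ℂ).toRingHom (X e) ∈ eliminationIdeal I E' := by
    have := hfI e
    rw [eliminationIdeal, Ideal.mem_comap]
    convert this
    change (rename ((↑) : E' → σ) : MvPolynomial E' ℂ →ₐ[ℂ] MvPolynomial σ ℂ).toRingHom _ = _
    rw [Polynomial.hom_eval₂]
    congr 1
    · ext i <;> simp
    · simp
  have h0 := hx _ hr
  change (aeval x : MvPolynomial E' ℂ →ₐ[ℂ] ℂ).toRingHom _ = _ at h0
  rw [Polynomial.hom_eval₂] at h0
  change Polynomial.eval _ _ = 0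
  rw [Polynomial.eval_map, ← h0]
  congr 1
  · ext i <;> simp [coordProj]
  · simp

/-! ### Exponent vectors and torus weights -/

/-- The exponent vector of the monomial `∏_j θ_{j,i_j}`. -/
noncomputable def exponent {n : ℕ} {d : Fin n → ℕ} (i : Index d) : Param d →₀ ℕ :=
  ∑ j, Finsupp.single ⟨j, i j⟩ 1

theorem prod_X_eq_monomial {n : ℕ} {d : Fin n → ℕ} (i : Index d) :
    (∏ j : Fin n, X (⟨j, i j⟩ : Param d) : MvPolynomial (Param d) ℂ) =
      monomial (exponent i) 1 := by
  rw [exponent, monomial_sum_one]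
  rfl

theorem segreHom_X {n : ℕ} {d : Fin n → ℕ} (i : Index d) :
    segreHom d (X i) = monomial (exponent i) 1 := by
  rw [segreHom, aeval_X, prod_X_eq_monomial]

theorem sum_mul_exponent {n : ℕ} {d : Fin n → ℕ} (w : Param d → ℚ) (i : Index d) :
    ∑ t, w t * (exponent i t : ℚ) = ∑ j, w ⟨j, i j⟩ := by
  classical
  simp only [exponent, Finsupp.coe_finsetSum, Finset.sum_apply, Nat.cast_sum, Finset.mul_sum]
  rw [Finset.sum_comm]
  refine Finset.sum_congr rfl fun j _ => ?_
  simp [Finsupp.single_apply]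

/-- Clearing denominators and separating signs turns the rational relation into a binomial `x_e ^ N
* x^m - x^p` in the toric ideal. Its leading coefficient is a monomial, and no monomial lies in that
ideal. -/
theorem mem_closure_of_exponent_mem_span {n : ℕ} {d : Fin n → ℕ} {E : Set (Index d)}
    {e : Index d}
    (he : (fun t => (exponent e t : ℚ)) ∈
      Submodule.span ℚ (Set.range fun (f : E) t => (exponent (f : Index d) t : ℚ))) :
    e ∈ (algebraicMatroid (toricIdeal d)).closure E := by
  classical
  have := Fintype.ofFinite E
  obtain ⟨c, hc⟩ := (Submodule.mem_span_range_iff_exists_fun ℚ).1 he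
  obtain ⟨⟨b, hb⟩, hbc⟩ := IsLocalization.exist_integer_multiples_of_finite
    (nonZeroDivisors ℤ) c
  choose z hz using hbc
  have hb0 : b ≠ 0 := nonZeroDivisors.ne_zero hb
  have hz' (f : E) : (z f : ℚ) = b * c f := by simpa using hz f
  -- The common denominator `b` may be negative; scaling by `b ^ 2` makes the exponent of `x_e`
  -- positive.
  set N : ℕ := b.natAbs ^ 2 with hN
  have hNb : (N : ℚ) = b * b := by
    have : (N : ℤ) = b * b := by rw [hN]; push_cast; rw [sq_abs, sq]
    exact_mod_cast this
  have hN0 : N ≠ 0 := pow_ne_zero _ (Int.natAbs_ne_zero.2 hb0)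
  set p : E → ℕ := fun f => (b * z f).toNat with hp
  set m : E → ℕ := fun f => (-(b * z f)).toNat with hm
  have hpm (f : E) : (p f : ℚ) = m f + b * z f := by
    have : (p f : ℤ) = m f + b * z f := by simp only [hp, hm]; omega
    exact_mod_cast this
  have hexp : N • exponent e + ∑ f, m f • exponent (f : Index d) =
      ∑ f, p f • exponent (f : Index d) := by
    ext t
    have hct := congrFun hc t
    simp only [Finset.sum_apply, Pi.smul_apply, smul_eq_mul] at hct
    simp only [Finsupp.coe_add, Finsupp.coe_smul, Finsupp.coe_finsetSum, Pi.add_apply,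
      Pi.smul_apply, Finset.sum_apply, smul_eq_mul]
    apply Nat.cast_injective (R := ℚ)
    push_cast
    rw [hNb, ← hct, Finset.mul_sum, ← Finset.sum_add_distrib]
    refine Finset.sum_congr rfl fun f _ => ?_
    rw [hpm, hz']
    ring
  have hsegre (r : E → ℕ) : segreHom d (rename ((↑) : E → Index d) (∏ f, X f ^ r f)) =
      monomial (∑ f, r f • exponent (f : Index d)) 1 := by
    simp only [map_prod, map_pow, rename_X, segreHom_X, monomial_pow, one_pow,
      monomial_sum_one]
  rw [mem_algebraicMatroid_closure_iff]
  refine ⟨Polynomial.monomial N (∏ f, X f ^ m f) - Polynomial.C (∏ f, X f ^ p f), ⟨N, ?_⟩, ?_⟩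
  · rw [Polynomial.coeff_sub, Polynomial.coeff_monomial_same, Polynomial.coeff_C_of_ne_zero hN0,
      sub_zero, eliminationIdeal, Ideal.mem_comap, toricIdeal, RingHom.mem_ker, hsegre]
    simp
  · rw [Polynomial.eval₂_sub, Polynomial.eval₂_monomial, Polynomial.eval₂_C, toricIdeal,
      RingHom.mem_ker]
    change segreHom d (rename _ _ * _ - rename _ _) = 0
    rw [map_sub, map_mul, map_pow, hsegre, hsegre, segreHom_X, monomial_pow, one_pow,
      monomial_mul, one_mul, add_comm, hexp, sub_self]

/-- If `e` is not in the closure of `E`, some one-parameter subgroup of the torus fixes all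
coordinates in `E` and moves the coordinate `e`. -/
theorem exists_weight_of_notMem_closure {n : ℕ} {d : Fin n → ℕ} {E : Set (Index d)} {e : Index d}
    (he : e ∉ (algebraicMatroid (toricIdeal d)).closure E) :
    ∃ w : Param d → ℚ, (∀ f ∈ E, ∑ j, w ⟨j, f j⟩ = 0) ∧ ∑ j, w ⟨j, e j⟩ ≠ 0 := by
  classical
  obtain ⟨F, hFe, hF⟩ := Submodule.exists_le_ker_of_notMem
    (mt mem_closure_of_exponent_mem_span he)
  have hFw (i : Index d) : F (fun t => (exponent i t : ℚ)) =
      ∑ j, F (Pi.single (⟨j, i j⟩ : Param d) 1) := by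
    rw [← sum_mul_exponent (fun t => F (Pi.single t 1)), LinearMap.pi_apply_eq_sum_univ F]
    refine Finset.sum_congr rfl fun t _ => ?_
    rw [smul_eq_mul, mul_comm]
    congr 2
    ext s
    simp [Pi.single_apply, eq_comm]
  refine ⟨fun t => F (Pi.single t 1), fun f hf => ?_, ?_⟩
  · rw [← hFw]
    exact hF (Submodule.subset_span ⟨⟨f, hf⟩, rfl⟩)
  · rwa [← hFw]

/-! ### Parametrized points and infinite fibres -/

/-- The point of the coordinate projection of the Segre variety with parameters `θ`. -/
def segrePoint {n : ℕ} {d : Fin n → ℕ} (E : Set (Index d)) (θ : Param d → ℂ) : E → ℂ :=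
  fun f => ∏ j, θ ⟨j, (f : Index d) j⟩

theorem aeval_segrePoint {n : ℕ} {d : Fin n → ℕ} (E : Set (Index d)) (θ : Param d → ℂ)
    (p : MvPolynomial E ℂ) :
    aeval (segrePoint E θ) p = aeval θ (segreHom d (rename ((↑) : E → Index d) p)) := by
  have : (aeval (segrePoint E θ) : MvPolynomial E ℂ →ₐ[ℂ] ℂ) =
      ((aeval θ).comp (segreHom d)).comp (rename ((↑) : E → Index d)) := by
    ext i
    simp [segrePoint, segreHom]
  rw [this]
  rfl

theorem segrePoint_mem {n : ℕ} {d : Fin n → ℕ} (E : Set (Index d)) (θ : Param d → ℂ) :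
    segrePoint E θ ∈ eliminationVariety (toricIdeal d) E := by
  intro p hp
  have h : segreHom d (rename ((↑) : E → Index d) p) = 0 := hp
  rw [aeval_segrePoint, h, map_zero]

theorem exists_segrePoint_mem {n : ℕ} {d : Fin n → ℕ} {E : Set (Index d)} {U : Set (E → ℂ)}
    (hU : IsZariskiOpenIn U (eliminationVariety (toricIdeal d) E))
    (hdense : IsZariskiDenseIn U (eliminationVariety (toricIdeal d) E)) :
    ∃ θ : Param d → ℂ, (∀ t, θ t ≠ 0) ∧ segrePoint E θ ∈ U := by
  obtain ⟨J, rfl⟩ := hU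
  obtain ⟨g, hgJ, hg⟩ : ∃ g ∈ J, g ∉ eliminationIdeal (toricIdeal d) E := by
    by_contra! hJ
    have hempty : eliminationVariety (toricIdeal d) E \ zeroLocus ℂ J = ∅ :=
      Set.sdiff_eq_empty.2 (zeroLocus_anti_mono hJ)
    -- An empty set is not dense: the polynomial 1 would vanish at a point of the variety.
    have h1 := hdense.2 (segrePoint_mem E 0) 1 (by simp [hempty])
    simp at h1
  have hg0 : segreHom d (rename ((↑) : E → Index d) g) ≠ 0 := hg
  -- The extra factor `∏ t, X t` forces all parameters to be nonzero at a point where the product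
  -- does not vanish.
  have hprod : segreHom d (rename ((↑) : E → Index d) g) * ∏ t, X t ≠ 0 :=
    mul_ne_zero hg0 (Finset.prod_ne_zero_iff.2 fun t _ => X_ne_zero t)
  obtain ⟨θ, hθ⟩ : ∃ θ : Param d → ℂ,
      eval θ (segreHom d (rename ((↑) : E → Index d) g) * ∏ t, X t) ≠ 0 := by
    by_contra! h
    exact hprod (MvPolynomial.funext fun θ => by rw [h θ, map_zero])
  rw [map_mul, map_prod] at hθ
  refine ⟨θ, fun t => ?_, segrePoint_mem E θ, fun h => left_ne_zero_of_mul hθ ?_⟩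
  · simpa using Finset.prod_ne_zero_iff.1 (right_ne_zero_of_mul hθ) t (Finset.mem_univ t)
  · have := h g hgJ
    rwa [aeval_segrePoint, aeval_eq_eval] at this

theorem subset_closure_of_isGenericallyFiniteToOne {n : ℕ} {d : Fin n → ℕ}
    {E E' : Set (Index d)} (h : E ⊆ E')
    (hfin : IsGenericallyFiniteToOne (coordProj h) (eliminationVariety (toricIdeal d) E')
      (eliminationVariety (toricIdeal d) E)) :
    E' ⊆ (algebraicMatroid (toricIdeal d)).closure E := by
  intro e he
  by_contra hecl
  obtain ⟨w, hwE, hwe⟩ := exists_weight_of_notMem_closure hecl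
  obtain ⟨-, U, hU, hdense, hfib⟩ := hfin
  obtain ⟨θ, hθ, hθU⟩ := exists_segrePoint_mem hU hdense
  -- Real exponentials allow rational weights and make the orbit injective in `s`.
  set γ : ℝ → Param d → ℂ := fun s t => θ t * Real.exp (s * w t) with hγ
  have hprod (s : ℝ) (i : Index d) : ∏ j, γ s ⟨j, i j⟩ =
      (∏ j, θ ⟨j, i j⟩) * (Real.exp (s * (∑ j, w ⟨j, i j⟩ : ℚ)) : ℝ) := by
    simp only [hγ, Finset.prod_mul_distrib]
    rw [Rat.cast_sum, Finset.mul_sum, Real.exp_sum]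
    push_cast
    rfl
  have hinj : Function.Injective fun s => segrePoint E' (γ s) := by
    intro s s' hss
    have h1 := congrFun hss ⟨e, he⟩
    simp only [segrePoint, hprod] at h1
    have h2 := mul_left_cancel₀ (Finset.prod_ne_zero_iff.2 fun j _ => hθ _) h1
    have h3 := Real.exp_injective (Complex.ofReal_injective h2)
    exact mul_right_cancel₀ (Rat.cast_ne_zero.2 hwe) h3
  refine Set.infinite_range_of_injective hinj ((hfib _ hθU).subset ?_)
  rintro _ ⟨s, rfl⟩
  refine ⟨segrePoint_mem E' _, funext fun f => ?_⟩
  change ∏ j, γ s ⟨j, (f : Index d) j⟩ = ∏ j, θ ⟨j, (f : Index d) j⟩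
  rw [hprod, hwE f f.2]
  simp

end RankOneTensor

theorem mainTheorem10 {n : ℕ} (d : Fin n → ℕ) (hd : ∀ j, 1 < d j)
    (E : Set (RankOneTensor.Index d)) :
    IsGreatest
      {E' : Set (RankOneTensor.Index d) | ∃ h : E ⊆ E',
        RankOneTensor.IsGenericallyFiniteToOne (RankOneTensor.coordProj h)
          (RankOneTensor.eliminationVariety (RankOneTensor.toricIdeal d) E')
          (RankOneTensor.eliminationVariety (RankOneTensor.toricIdeal d) E)}
      ((RankOneTensor.algebraicMatroid (RankOneTensor.toricIdeal d)).closure E) :=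
  ⟨⟨RankOneTensor.subset_algebraicMatroid_closure _ E,
    RankOneTensor.isGenericallyFiniteToOne_closure _ E⟩,
    fun _ ⟨h, hfin⟩ => RankOneTensor.subset_closure_of_isGenericallyFiniteToOne h hfin⟩
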